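/- **Setting.** There are $N\ge 2$ agents, $K\ge 1$ arms and $T\ge 1$ rounds. In round $t\in\{1,\dots,T\}$ a utility matrix $u_t\in[0,1]^{K\times N}$ is drawn i.i.d. from an unknown distribution with mean matrix $u$ (the entries of one matrix may be dependent). The learner picks $p_t$ in the simplex $\Delta_K$, using the past only, samples an arm $i_t\sim p_t$, and observes $u_{t,i_t,n}$ for all agents $n$. Let $\mathrm{NSW}(\mu)=\prod_{n=1}^N\mu_n^{1/N}$ and $$\mathrm{Reg}_{\mathrm{sto}}=T\max_{p\in\Delta_K}\mathrm{NSW}(u^\top p)-\mathbb E\Big[\sum_{t=1}^T\mathrm{NSW}(u^\top p_t)\Big],$$ where the expectation is over all randomness of the learner and of the utilities. **Algorithm.** Let $N_0=1+18\log(KT)$. In rounds $t\le KN_0$ select $i_t=\lceil t/N_0\rceil$ (that is, $p_t$ is the point mass at this arm). In rounds $t>KN_0$ choose any $p_t\in\arg\max_{p\in\Delta_K}\mathrm{NSW}(\widehat u_t^\top p)$ and sample $i_t\sim p_t$. Here, with $N_{t+1,i}=|\{\tau\le t: i_\tau=i\}|$ and $\bar u_{t,i,n}=\frac1{N_{t+1,i}}\sum_{\tau\le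 t}u_{\tau,i,n}\mathbf 1\{i_\tau=i\}$, $$\widehat u_{t+1,i,n}=\bar u_{t,i,n}+4\sqrt{\frac{\bar u_{t,i,n}\log(NKT^2)}{N_{t+1,i}}}+\frac{8\log(NKT^2)}{N_{t+1,i}}$$ (and $\widehat u_{t+1,i,n}=1$ as long as $N_{t+1,i}=0$). **Theorem.** The algorithm achieves $\mathrm{Reg}_{\mathrm{sto}}=\widetilde O\big(K^{2/N}T^{(N-1)/N}+K\big)$, where $\widetilde O$ hides factors polylogarithmic in $N,K,T$. That is, there are universal constants $C$ and $m$ such that for all $N\ge2$, $K\ge1$, $T\ge1$, all utility distributions on $[0,1]^{K\times N}$ and all rules for breaking ties in the $\arg\max$ that use the past only, $$\mathrm{Reg}_{\mathrm{sto}}\le C\,\big(1+\log(NKT)\big)^m\Big(K^{2/N}\,T^{(N-1)/N}+K\Big).$$ -/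

import Mathlib

open MeasureTheory ProbabilityTheory

noncomputable section

namespace NashBandit

/-- Nash social welfare of a vector of `N` utilities: the geometric mean. -/
def NSW {N : ℕ} (x : Fin N → ℝ) : ℝ :=
  ∏ n, x n ^ (1 / (N : ℝ))

/-- The vector `uᵀ p` of the agents' expected utilities when an arm is drawn from `p` and `u i n` is
the utility of agent `n` for arm `i`. -/
def expectedUtility {K N : ℕ} (u : Fin K → Fin N → ℝ) (p : Fin K → ℝ) : Fin N → ℝ :=
  fun n => ∑ i, p i * u i n

/-- The welfare `NSW(uᵀ p)` of the strategy `p` under the utility matrix `u`. -/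
def welfare {K N : ℕ} (u : Fin K → Fin N → ℝ) (p : Fin K → ℝ) : ℝ :=
  NSW (expectedUtility u p)

/-- The mean utility matrix of a distribution `ν` over utility matrices. -/
def meanUtility {K N : ℕ} (ν : Measure (Fin K → Fin N → ℝ)) : Fin K → Fin N → ℝ :=
  fun i n => ∫ v, v i n ∂ν

/-! ### Quantities computed by the algorithm

Below `a t` is the arm selected in round `t` and `v t` the utility matrix of round `t`, where rounds
are numbered from `1`. Of `v t` only the row `a t` is used. -/

/-- Number of times arm `i` is selected in the rounds `1, …, t`. -/
def pullCount {K : ℕ} (a : ℕ → Fin K) (t : ℕ) (i : Fin K) : ℕ :=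
  ((Finset.Icc 1 t).filter fun τ => a τ = i).card

/-- Empirical mean utility of agent `n` for arm `i` over the rounds `1, …, t` in which `i` is
selected. -/
def empiricalMean {K N : ℕ} (a : ℕ → Fin K) (v : ℕ → Fin K → Fin N → ℝ) (t : ℕ)
    (i : Fin K) (n : Fin N) : ℝ :=
  (∑ τ ∈ Finset.Icc 1 t, if a τ = i then v τ i n else 0) / (pullCount a t i : ℝ)

/-- The upper confidence utility matrix with Bernstein-type widths, as it stands after `t` rounds
(so it is used in round `t + 1`), for horizon `T`. Entries of arms which have not been selected yet
keep their initial value `1`. -/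
def upperConfidence {K N : ℕ} (T : ℕ) (a : ℕ → Fin K) (v : ℕ → Fin K → Fin N → ℝ) (t : ℕ) :
    Fin K → Fin N → ℝ :=
  fun i n =>
    if pullCount a t i = 0 then 1
    else
      empiricalMean a v t i n
        + 4 * √(empiricalMean a v t i n * Real.log (N * K * T ^ 2) / pullCount a t i)
        + 8 * Real.log (N * K * T ^ 2) / pullCount a t i

/-! ### The interaction between learner and environment -/

/-- The stochastic bandit protocol over `T` rounds. `U t` is the utility matrix, `p t` the learner's
strategy and `I t` the selected arm in round `t ∈ {1, …, T}`; `ℱ t` is the information available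
at the end of round `t`. The matrix of each round has law `ν` and is independent of the past and of
the arm selected in that round; given the past, the arm is drawn from the learner's strategy. -/
structure IsBanditInteraction {Ω : Type*} {mΩ : MeasurableSpace Ω} {K N : ℕ} (T : ℕ)
    (ν : Measure (Fin K → Fin N → ℝ)) (μ : Measure Ω) (ℱ : Filtration ℕ mΩ)
    (U : ℕ → Ω → Fin K → Fin N → ℝ) (p : ℕ → Ω → Fin K → ℝ) (I : ℕ → Ω → Fin K) : Prop where
  utility_measurable : ∀ t < T, Measurable[ℱ (t + 1)] (U (t + 1))
  arm_measurable : ∀ t < T, Measurable[ℱ (t + 1)] (I (t + 1))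
  utility_law : ∀ t < T, HasLaw (U (t + 1)) ν μ
  utility_indep : ∀ t < T,
    Indep (MeasurableSpace.comap (U (t + 1)) inferInstance)
      (ℱ t ⊔ MeasurableSpace.comap (I (t + 1)) inferInstance) μ
  strategy_measurable : ∀ t < T, Measurable[ℱ t] (p (t + 1))
  strategy_mem : ∀ t < T, ∀ᵐ ω ∂μ, p (t + 1) ω ∈ stdSimplex ℝ (Fin K)
  arm_law : ∀ t < T, ∀ i : Fin K,
    μ[Set.indicator {ω | I (t + 1) ω = i} (fun _ => (1 : ℝ)) | ℱ t] =ᵐ[μ] fun ω => p (t + 1) ω i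

/-- The learner plays UCB with warm-up length `N₀`: in a round `t ≤ K N₀` it selects the arm number
`⌈t / N₀⌉` (arms being numbered `1, …, K`), and in every later round its strategy maximizes the
welfare under the upper confidence utility matrix over the simplex, ties being broken arbitrarily. -/
structure PlaysUCB {Ω : Type*} {mΩ : MeasurableSpace Ω} {K N : ℕ} (T : ℕ) (N₀ : ℝ)
    (μ : Measure Ω) (U : ℕ → Ω → Fin K → Fin N → ℝ) (p : ℕ → Ω → Fin K → ℝ)
    (I : ℕ → Ω → Fin K) : Prop where
  warmup : ∀ t < T, ((t + 1 : ℕ) : ℝ) ≤ K * N₀ → ∀ᵐ ω ∂μ, ∀ i : Fin K,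
    p (t + 1) ω i = if (i : ℕ) + 1 = ⌈((t + 1 : ℕ) : ℝ) / N₀⌉₊ then 1 else 0
  optimistic : ∀ t < T, K * N₀ < ((t + 1 : ℕ) : ℝ) → ∀ᵐ ω ∂μ,
    IsMaxOn (welfare (upperConfidence T (fun τ => I τ ω) (fun τ => U τ ω) t))
      (stdSimplex ℝ (Fin K)) (p (t + 1) ω)

/-- The regret of the strategies `p 1, …, p T` against the best fixed strategy, for the mean utility
matrix `u`. -/
def regret {Ω : Type*} {mΩ : MeasurableSpace Ω} {K N : ℕ} (T : ℕ) (u : Fin K → Fin N → ℝ)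
    (μ : Measure Ω) (p : ℕ → Ω → Fin K → ℝ) : ℝ :=
  T * sSup (welfare u '' stdSimplex ℝ (Fin K))
    - ∫ ω, ∑ t ∈ Finset.Icc 1 T, welfare u (p t ω) ∂μ

end NashBandit

end

/-!
Optimism: while every upper confidence utility is at least its mean, the maximizer `p` of the
optimistic welfare satisfies `welfare u q ≤ welfare û p` for every `q`, so that a round costs at
most `welfare û p - welfare u p`. On the square-root scale the Bernstein widths read
`√(û i n) ≤ √(u i n) + √(g i)` with `g i ≈ log (N K T²) / N_i`, where `N_i` is the number of samples
of arm `i`, and Cauchy–Schwarz carries this over to the mixture `p`. It then suffices that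
`NSW ((√x + √w)²) ≤ NSW x + 16 (w^(1/N) + w)` with a constant independent of `N`: either a
coordinate of `x` is below `w`, and both sides are of order `w^(1/N)`, or the relative perturbation
`√(w / x n)` is at most `1`, and `NSW x * √(w / x n) ≤ w^(1/N)` because `NSW x ≤ (x n)^(1/N)`.

The root is linearized by its tangent, `w^(1/N) ≤ a^(1/N) + a^(1/N - 1) w`, where the average of `w`
over the learner's strategy is the expected width of the arm that is pulled. Over all rounds these
widths add up to `K` harmonic sums, and `a = K / T` balances the two terms.

The confidence bounds hold outside an event of probability `O(1 / T)`: for each arm, agent, sign and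
possible number of samples, Markov's inequality applies to an exponential supermartingale which
moves only when the arm is pulled.
-/

namespace NashBandit

/-! ### Stability of the Nash social welfare -/

section NashSocialWelfare

variable {N : ℕ} {x y : Fin N → ℝ} {w : ℝ}

theorem NSW_nonneg (hx : ∀ n, 0 ≤ x n) : 0 ≤ NSW x :=
  Finset.prod_nonneg fun n _ => Real.rpow_nonneg (hx n) _

theorem NSW_mono (hx : ∀ n, 0 ≤ x n) (hxy : ∀ n, x n ≤ y n) : NSW x ≤ NSW y :=
  Finset.prod_le_prod (fun n _ => Real.rpow_nonneg (hx n) _)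
    fun n _ => Real.rpow_le_rpow (hx n) (hxy n) (by positivity)

theorem NSW_mul (hx : ∀ n, 0 ≤ x n) (hy : ∀ n, 0 ≤ y n) :
    NSW (fun n => x n * y n) = NSW x * NSW y := by
  simp only [NSW, Real.mul_rpow (hx _) (hy _), Finset.prod_mul_distrib]

theorem NSW_const (hN : N ≠ 0) {c : ℝ} (hc : 0 ≤ c) : NSW (fun _ : Fin N => c) = c := by
  rw [NSW, Fin.prod_const, one_div, Real.rpow_inv_natCast_pow hc hN]

theorem NSW_exp (f : Fin N → ℝ) :
    NSW (fun n => Real.exp (f n)) = Real.exp ((∑ n, f n) / N) := by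
  simp only [NSW, ← Real.exp_mul, ← Real.exp_sum, ← Finset.sum_div, mul_one_div]

theorem NSW_le_rpow (hx : ∀ n, x n ∈ Set.Icc (0 : ℝ) 1) (m : Fin N) :
    NSW x ≤ x m ^ (1 / (N : ℝ)) := by
  rw [NSW, ← Finset.mul_prod_erase _ _ (Finset.mem_univ m)]
  refine mul_le_of_le_one_right (Real.rpow_nonneg (hx m).1 _) ?_
  exact Finset.prod_le_one (fun n _ => Real.rpow_nonneg (hx n).1 _)
    fun n _ => Real.rpow_le_one (hx n).1 (hx n).2 (by positivity)

theorem NSW_le_one (hx : ∀ n, x n ∈ Set.Icc (0 : ℝ) 1) : NSW x ≤ 1 :=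
  Finset.prod_le_one (fun n _ => Real.rpow_nonneg (hx n).1 _)
    fun n _ => Real.rpow_le_one (hx n).1 (hx n).2 (by positivity)

theorem sq_sqrt_add_sqrt_le_four_mul_max {a b : ℝ} (ha : 0 ≤ a) :
    (√a + √b) ^ 2 ≤ 4 * max a b := by
  calc (√a + √b) ^ 2 ≤ (√(max a b) + √(max a b)) ^ 2 := by
        gcongr
        exacts [le_max_left a b, le_max_right a b]
    _ = 4 * max a b := by
        rw [← two_mul, mul_pow, Real.sq_sqrt (ha.trans (le_max_left a b))]
        norm_num

theorem NSW_sq_sqrt_add_sqrt_le_four_mul (hN : N ≠ 0) (hx : ∀ n, 0 ≤ x n) :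
    NSW (fun n => (√(x n) + √w) ^ 2) ≤ 4 * NSW fun n => max (x n) w := by
  calc NSW (fun n => (√(x n) + √w) ^ 2) ≤ NSW fun n => 4 * max (x n) w :=
        NSW_mono (fun n => sq_nonneg _) fun n => sq_sqrt_add_sqrt_le_four_mul_max (hx n)
    _ = 4 * NSW fun n => max (x n) w := by
        rw [NSW_mul (fun _ => by norm_num) fun n => (hx n).trans (le_max_left _ _),
          NSW_const hN (by norm_num)]

theorem NSW_sq_sqrt_add_sqrt_le_of_one_le (hN : N ≠ 0) (hx : ∀ n, x n ∈ Set.Icc (0 : ℝ) 1)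
    (hw : 1 ≤ w) : NSW (fun n => (√(x n) + √w) ^ 2) ≤ 4 * w := by
  have hmax : (fun n => max (x n) w) = fun _ => w :=
    funext fun n => max_eq_right ((hx n).2.trans hw)
  calc _ ≤ 4 * NSW fun n => max (x n) w :=
        NSW_sq_sqrt_add_sqrt_le_four_mul hN fun n => (hx n).1
    _ = 4 * w := by rw [hmax, NSW_const hN (zero_le_one.trans hw)]

theorem NSW_sq_sqrt_add_sqrt_le_of_exists_le (hx : ∀ n, x n ∈ Set.Icc (0 : ℝ) 1) (hw : w ≤ 1)
    {m : Fin N} (hm : x m ≤ w) :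
    NSW (fun n => (√(x n) + √w) ^ 2) ≤ 4 * w ^ (1 / (N : ℝ)) := by
  calc _ ≤ 4 * NSW fun n => max (x n) w :=
        NSW_sq_sqrt_add_sqrt_le_four_mul m.pos.ne' fun n => (hx n).1
    _ ≤ 4 * max (x m) w ^ (1 / (N : ℝ)) := by
        gcongr
        exact NSW_le_rpow
          (fun n => ⟨(hx n).1.trans (le_max_left _ _), max_le (hx n).2 hw⟩) m
    _ = 4 * w ^ (1 / (N : ℝ)) := by rw [max_eq_right hm]

theorem exp_le_one_add_mul_exp {z b : ℝ} (hz : 0 ≤ z) (hzb : z ≤ b) :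
    Real.exp z ≤ 1 + z * Real.exp b := by
  have hneg : 1 - z ≤ Real.exp (-z) := Real.one_sub_le_exp_neg z
  have hinv : Real.exp (-z) * Real.exp z = 1 := by
    rw [← Real.exp_add, neg_add_cancel, Real.exp_zero]
  have hb : z * Real.exp z ≤ z * Real.exp b := by gcongr
  nlinarith [Real.exp_pos z]

theorem exp_two_le_eight : Real.exp 2 ≤ 8 := by
  have hsq : Real.exp 2 = Real.exp 1 ^ 2 := by rw [← Real.exp_nat_mul]; norm_num
  rw [hsq]
  nlinarith [Real.exp_one_lt_d9, Real.exp_pos 1]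

theorem NSW_sq_sqrt_add_sqrt_le_mul_exp (hx : ∀ n, 0 < x n) :
    NSW (fun n => (√(x n) + √w) ^ 2) ≤ NSW x * Real.exp (2 * ((∑ n, √(w / x n)) / N)) := by
  have hfactor (n : Fin N) : (√(x n) + √w) ^ 2 = x n * (1 + √(w / x n)) ^ 2 := by
    have hroot : √(x n) * √(w / x n) = √w := by
      rw [← Real.sqrt_mul (hx n).le, mul_div_cancel₀ _ (hx n).ne']
    rw [← hroot, ← mul_one_add, mul_pow, Real.sq_sqrt (hx n).le]
  have hexp (n : Fin N) : (1 + √(w / x n)) ^ 2 ≤ Real.exp (2 * √(w / x n)) := by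
    rw [two_mul, Real.exp_add, ← sq]
    gcongr
    linarith [Real.add_one_le_exp √(w / x n)]
  calc _ = NSW x * NSW fun n => (1 + √(w / x n)) ^ 2 := by
        simp only [hfactor]
        exact NSW_mul (fun n => (hx n).le) fun n => sq_nonneg _
    _ ≤ NSW x * NSW fun n => Real.exp (2 * √(w / x n)) :=
        mul_le_mul_of_nonneg_left (NSW_mono (fun n => sq_nonneg _) hexp)
          (NSW_nonneg fun n => (hx n).le)
    _ = _ := by rw [NSW_exp, ← Finset.mul_sum, mul_div_assoc]

theorem NSW_mul_sqrt_div_le_rpow (hN : 2 ≤ N) (hx : ∀ n, x n ∈ Set.Icc (0 : ℝ) 1) (hw : 0 ≤ w)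
    {m : Fin N} (hm : w < x m) : NSW x * √(w / x m) ≤ w ^ (1 / (N : ℝ)) := by
  have hxm : 0 < x m := hw.trans_lt hm
  have hN2 : 1 / (N : ℝ) ≤ 1 / 2 := by gcongr; exact_mod_cast hN
  have hroot : √(w / x m) ≤ (w / x m) ^ (1 / (N : ℝ)) := by
    rw [Real.sqrt_eq_rpow]
    exact Real.rpow_le_rpow_of_exponent_ge_of_imp (by positivity) ((div_le_one hxm).mpr hm.le) hN2
      fun _ h => absurd h (by positivity)
  calc NSW x * √(w / x m) ≤ x m ^ (1 / (N : ℝ)) * (w / x m) ^ (1 / (N : ℝ)) :=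
        mul_le_mul (NSW_le_rpow hx m) hroot (Real.sqrt_nonneg _) (Real.rpow_nonneg hxm.le _)
    _ = w ^ (1 / (N : ℝ)) := by
        rw [← Real.mul_rpow hxm.le (by positivity), mul_div_cancel₀ _ hxm.ne']

theorem NSW_sq_sqrt_add_sqrt_le_of_forall_lt (hN : 2 ≤ N) (hx : ∀ n, x n ∈ Set.Icc (0 : ℝ) 1)
    (hw : 0 ≤ w) (hwx : ∀ n, w < x n) :
    NSW (fun n => (√(x n) + √w) ^ 2) ≤ NSW x + 16 * w ^ (1 / (N : ℝ)) := by
  have hN0 : (0 : ℝ) < N := by positivity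
  have hpos (n : Fin N) : 0 < x n := hw.trans_lt (hwx n)
  have avg_le {f : Fin N → ℝ} {c : ℝ} (hf : ∀ n, f n ≤ c) : (∑ n, f n) / N ≤ c := by
    rw [div_le_iff₀' hN0]
    simpa using Finset.sum_le_card_nsmul Finset.univ f c fun n _ => hf n
  set r : ℝ := (∑ n, √(w / x n)) / N with hr
  have hr0 : 0 ≤ r := by positivity
  have hr1 : r ≤ 1 := avg_le fun n => Real.sqrt_le_one.mpr ((div_le_one (hpos n)).mpr (hwx n).le)
  have hrw : NSW x * r ≤ w ^ (1 / (N : ℝ)) := by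
    rw [hr, mul_div_assoc', Finset.mul_sum]
    exact avg_le fun n => NSW_mul_sqrt_div_le_rpow hN hx hw (hwx n)
  have hexp : Real.exp (2 * r) ≤ 1 + 2 * r * 8 :=
    (exp_le_one_add_mul_exp (b := 2) (mul_nonneg zero_le_two hr0) (by linarith)).trans
      (by gcongr; exact exp_two_le_eight)
  calc _ ≤ NSW x * Real.exp (2 * r) := NSW_sq_sqrt_add_sqrt_le_mul_exp hpos
    _ ≤ NSW x * (1 + 2 * r * 8) :=
        mul_le_mul_of_nonneg_left hexp (NSW_nonneg fun n => (hx n).1)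
    _ = NSW x + 16 * (NSW x * r) := by ring
    _ ≤ NSW x + 16 * w ^ (1 / (N : ℝ)) := by gcongr

theorem NSW_sq_sqrt_add_sqrt_le (hN : 2 ≤ N) (hx : ∀ n, x n ∈ Set.Icc (0 : ℝ) 1) (hw : 0 ≤ w) :
    NSW (fun n => (√(x n) + √w) ^ 2) ≤ NSW x + 16 * (w ^ (1 / (N : ℝ)) + w) := by
  have hNSW : 0 ≤ NSW x := NSW_nonneg fun n => (hx n).1
  have hroot : 0 ≤ w ^ (1 / (N : ℝ)) := Real.rpow_nonneg hw _
  rcases le_total 1 w with hw1 | hw1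
  · linarith [NSW_sq_sqrt_add_sqrt_le_of_one_le (by omega) hx hw1]
  by_cases hsmall : ∃ m, x m ≤ w
  · obtain ⟨m, hm⟩ := hsmall
    linarith [NSW_sq_sqrt_add_sqrt_le_of_exists_le hx hw1 hm]
  · push Not at hsmall
    linarith [NSW_sq_sqrt_add_sqrt_le_of_forall_lt hN hx hw hsmall]

end NashSocialWelfare

section Welfare

variable {K N : ℕ} {u û : Fin K → Fin N → ℝ} {p q : Fin K → ℝ} {g : Fin K → ℝ}

theorem expectedUtility_mem_Icc (hu : ∀ i n, u i n ∈ Set.Icc (0 : ℝ) 1)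
    (hp : p ∈ stdSimplex ℝ (Fin K)) (n : Fin N) : expectedUtility u p n ∈ Set.Icc (0 : ℝ) 1 := by
  refine ⟨Finset.sum_nonneg fun i _ => mul_nonneg (hp.1 i) (hu i n).1, ?_⟩
  rw [← hp.2]
  exact Finset.sum_le_sum fun i _ => mul_le_of_le_one_right (hp.1 i) (hu i n).2

theorem welfare_mem_Icc (hu : ∀ i n, u i n ∈ Set.Icc (0 : ℝ) 1) (hp : p ∈ stdSimplex ℝ (Fin K)) :
    welfare u p ∈ Set.Icc (0 : ℝ) 1 :=
  ⟨NSW_nonneg fun n => (expectedUtility_mem_Icc hu hp n).1,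
    NSW_le_one (expectedUtility_mem_Icc hu hp)⟩

theorem welfare_mono (hu : ∀ i n, 0 ≤ u i n) (huv : ∀ i n, u i n ≤ û i n) (hp : ∀ i, 0 ≤ p i) :
    welfare u p ≤ welfare û p :=
  NSW_mono (fun n => Finset.sum_nonneg fun i _ => mul_nonneg (hp i) (hu i n))
    fun n => Finset.sum_le_sum fun i _ => mul_le_mul_of_nonneg_left (huv i n) (hp i)

theorem measurable_welfare (u : Fin K → Fin N → ℝ) : Measurable (welfare u) := by
  unfold welfare NSW expectedUtility
  fun_prop

theorem sum_mul_sq_sqrt_add_sqrt_le {ι : Type*} [Fintype ι] {p f g : ι → ℝ} (hp : ∀ i, 0 ≤ p i)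
    (hf : ∀ i, 0 ≤ f i) (hg : ∀ i, 0 ≤ g i) :
    ∑ i, p i * (√(f i) + √(g i)) ^ 2 ≤ (√(∑ i, p i * f i) + √(∑ i, p i * g i)) ^ 2 := by
  have hpf (i : ι) : 0 ≤ p i * f i := mul_nonneg (hp i) (hf i)
  have hpg (i : ι) : 0 ≤ p i * g i := mul_nonneg (hp i) (hg i)
  have hexpand (i : ι) : p i * (√(f i) + √(g i)) ^ 2
      = p i * f i + 2 * (√(p i * f i) * √(p i * g i)) + p i * g i := by
    have hcross : √(p i * f i) * √(p i * g i) = p i * (√(f i) * √(g i)) := by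
      rw [Real.sqrt_mul (hp i), Real.sqrt_mul (hp i), mul_mul_mul_comm, Real.mul_self_sqrt (hp i)]
    rw [hcross, add_sq, Real.sq_sqrt (hf i), Real.sq_sqrt (hg i)]
    ring
  rw [add_sq, Real.sq_sqrt (Finset.sum_nonneg fun i _ => hpf i),
    Real.sq_sqrt (Finset.sum_nonneg fun i _ => hpg i)]
  simp only [hexpand, Finset.sum_add_distrib, ← Finset.mul_sum]
  linarith [Real.sum_sqrt_mul_sqrt_le Finset.univ hpf hpg]

theorem welfare_le_welfare_add (hN : 2 ≤ N) (hu : ∀ i n, u i n ∈ Set.Icc (0 : ℝ) 1)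
    (hû : ∀ i n, 0 ≤ û i n) (hg : ∀ i, 0 ≤ g i) (hup : ∀ i n, û i n ≤ (√(u i n) + √(g i)) ^ 2)
    (hp : p ∈ stdSimplex ℝ (Fin K)) :
    welfare û p ≤
      welfare u p + 16 * ((∑ i, p i * g i) ^ (1 / (N : ℝ)) + ∑ i, p i * g i) := by
  calc welfare û p ≤ NSW fun n => (√(expectedUtility u p n) + √(∑ i, p i * g i)) ^ 2 :=
        NSW_mono (fun n => Finset.sum_nonneg fun i _ => mul_nonneg (hp.1 i) (hû i n)) fun n =>
          (Finset.sum_le_sum fun i _ => mul_le_mul_of_nonneg_left (hup i n) (hp.1 i)).trans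
            (sum_mul_sq_sqrt_add_sqrt_le hp.1 (fun i => (hu i n).1) hg)
    _ ≤ _ := NSW_sq_sqrt_add_sqrt_le hN (expectedUtility_mem_Icc hu hp)
        (Finset.sum_nonneg fun i _ => mul_nonneg (hp.1 i) (hg i))

/- Keeping `a` free linearizes the `N`-th root, so that the bound can be averaged and summed. -/
theorem rpow_le_add_mul {a w β : ℝ} (ha : 0 < a) (hw : 0 ≤ w) (hβ0 : 0 ≤ β) (hβ1 : β ≤ 1) :
    w ^ β ≤ a ^ β + a ^ (β - 1) * w := by
  rcases le_total w a with hwa | haw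
  · have hmono : w ^ β ≤ a ^ β := Real.rpow_le_rpow hw hwa hβ0
    have hrest : 0 ≤ a ^ (β - 1) * w := by positivity
    linarith
  · have hwpos : 0 < w := ha.trans_le haw
    calc w ^ β = w ^ (β - 1) * w := by rw [Real.rpow_sub_one hwpos.ne', div_mul_cancel₀ _ hwpos.ne']
      _ ≤ a ^ (β - 1) * w := by
          gcongr ?_ * w
          exact Real.rpow_le_rpow_of_nonpos ha haw (by linarith)
      _ ≤ a ^ β + a ^ (β - 1) * w := le_add_of_nonneg_left (by positivity)

theorem welfare_sub_le_of_isMaxOn (hN : 2 ≤ N) (hu : ∀ i n, u i n ∈ Set.Icc (0 : ℝ) 1)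
    (hlow : ∀ i n, u i n ≤ û i n) (hg : ∀ i, 0 ≤ g i)
    (hup : ∀ i n, û i n ≤ (√(u i n) + √(g i)) ^ 2)
    (hp : p ∈ stdSimplex ℝ (Fin K)) (hq : q ∈ stdSimplex ℝ (Fin K))
    (hmax : IsMaxOn (welfare û) (stdSimplex ℝ (Fin K)) p) {a : ℝ} (ha : 0 < a) :
    welfare u q - welfare u p ≤
      16 * (a ^ (1 / (N : ℝ)) + (a ^ (1 / (N : ℝ) - 1) + 1) * ∑ i, p i * g i) := by
  have hoptimism : welfare u q ≤ welfare û p :=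
    (welfare_mono (fun i n => (hu i n).1) hlow hq.1).trans (hmax hq)
  have hstable := welfare_le_welfare_add hN hu (fun i n => (hu i n).1.trans (hlow i n)) hg hup hp
  have hroot := rpow_le_add_mul (w := ∑ i, p i * g i) (β := 1 / (N : ℝ)) ha
    (Finset.sum_nonneg fun i _ => mul_nonneg (hp.1 i) (hg i)) (by positivity)
    (div_le_one_of_le₀ (by exact_mod_cast one_le_two.trans hN) (by positivity))
  linarith

end Welfare

/-! ### Sums over the pulls -/

section PullCount

variable {K : ℕ} (a : ℕ → Fin K)

theorem pullCount_eq_sum (t : ℕ) (i : Fin K) :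
    pullCount a t i = ∑ τ ∈ Finset.Icc 1 t, if a τ = i then 1 else 0 :=
  Finset.card_filter _ _

theorem pullCount_succ (t : ℕ) (i : Fin K) :
    pullCount a (t + 1) i = pullCount a t i + if a (t + 1) = i then 1 else 0 := by
  rw [pullCount_eq_sum, pullCount_eq_sum, Finset.sum_Icc_succ_top (by omega)]

theorem pullCount_le (t : ℕ) (i : Fin K) : pullCount a t i ≤ t :=
  (Finset.card_filter_le _ _).trans_eq (Nat.card_Icc 1 t)

/- Sorted by arm, the counts met by the successive pulls of arm `i` are `0, 1, 2, …`. -/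
theorem sum_pullCount_arm {M : Type*} [AddCommMonoid M] (f : ℕ → M) (T : ℕ) :
    ∑ t ∈ Finset.range T, f (pullCount a t (a (t + 1)))
      = ∑ i, ∑ s ∈ Finset.range (pullCount a T i), f s := by
  induction T with
  | zero => simp [pullCount]
  | succ T ih =>
    have hstep (i : Fin K) : ∑ s ∈ Finset.range (pullCount a (T + 1) i), f s
        = ∑ s ∈ Finset.range (pullCount a T i), f s
          + if a (T + 1) = i then f (pullCount a T i) else 0 := by
      rw [pullCount_succ]
      split_ifs
      · rw [Finset.sum_range_succ]
      · simp only [add_zero]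
    simp only [Finset.sum_range_succ, ih, hstep, Finset.sum_add_distrib, Finset.sum_ite_eq,
      Finset.mem_univ, if_true]

theorem sum_range_one_div_max_one_le (m : ℕ) :
    ∑ s ∈ Finset.range m, 1 / max (s : ℝ) 1 ≤ 2 + Real.log m := by
  cases m with
  | zero => simp
  | succ m =>
    have hharmonic : ∑ s ∈ Finset.range m, 1 / max ((s + 1 : ℕ) : ℝ) 1 = harmonic m := by
      simp [harmonic]
    have hlog : Real.log m ≤ Real.log (m + 1 : ℕ) := by
      rcases m.eq_zero_or_pos with rfl | hm
      · simp
      · gcongr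
        exact m.le_succ
    calc ∑ s ∈ Finset.range (m + 1), 1 / max (s : ℝ) 1 = harmonic m + 1 := by
          rw [Finset.sum_range_succ', hharmonic]
          simp
      _ ≤ 2 + Real.log (m + 1 : ℕ) := by linarith [harmonic_le_one_add_log m]

theorem sum_one_div_max_pullCount_le (T : ℕ) :
    ∑ t ∈ Finset.range T, 1 / max (pullCount a t (a (t + 1)) : ℝ) 1 ≤ K * (2 + Real.log T) := by
  rw [sum_pullCount_arm a (fun s : ℕ => 1 / max (s : ℝ) 1)]
  calc ∑ i, ∑ s ∈ Finset.range (pullCount a T i), 1 / max (s : ℝ) 1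
      ≤ ∑ _i : Fin K, (2 + Real.log T) := by
        refine Finset.sum_le_sum fun i _ => le_trans ?_ (sum_range_one_div_max_one_le T)
        exact Finset.sum_le_sum_of_subset_of_nonneg (Finset.range_mono (pullCount_le a T i))
          fun s _ _ => by positivity
    _ = K * (2 + Real.log T) := by
        rw [Finset.sum_const, Finset.card_univ, Fintype.card_fin, nsmul_eq_mul]

end PullCount

/-! ### Bernstein confidence bounds -/

section Deviation

variable {q c e d : ℝ}

/-- The tilt `λ` of the test martingale `exp (logWealth λ c)` which detects a deviation from the
mean `c` when `q` is the ratio of the confidence exponent to the number of samples: the minimizer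
`√(2 * q / c)` of `2 * q / λ + λ * c`, capped at `1`. -/
noncomputable def deviationRate (q c : ℝ) : ℝ :=
  if c ≤ 2 * q then 1 else √(2 * q / c)

theorem abs_deviationRate_le_one (hq : 0 ≤ q) : |deviationRate q c| ≤ 1 := by
  rw [deviationRate]
  split_ifs with hc
  · exact abs_one.le
  · rw [abs_of_nonneg (Real.sqrt_nonneg _), Real.sqrt_le_one]
    exact div_le_one_of_le₀ (not_le.mp hc).le ((mul_nonneg zero_le_two hq).trans (not_le.mp hc).le)

theorem le_sqrt_mul_sqrt (hc : 0 ≤ c) (hcq : c ≤ 2 * q) : c ≤ √(2 * q) * √c := by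
  calc c = √c * √c := (Real.mul_self_sqrt hc).symm
    _ ≤ √(2 * q) * √c := by gcongr

theorem le_two_mul_of_deviationRate_mul_lt (hq : 0 < q) (hcq : 2 * q < c)
    (hd : deviationRate q c * d - deviationRate q c ^ 2 * c < 2 * q) :
    d ≤ 2 * (√(2 * q) * √c) := by
  have hc : 0 < c := by linarith
  have hrate : deviationRate q c = √(2 * q) / √c := by
    rw [deviationRate, if_neg hcq.not_ge, Real.sqrt_div (by positivity)]
  have hsq : deviationRate q c ^ 2 * c = 2 * q := by
    rw [hrate, div_pow, Real.sq_sqrt (by positivity), Real.sq_sqrt hc.le, div_mul_cancel₀ _ hc.ne']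
  have hmul : deviationRate q c * c = √(2 * q) * √c := by
    rw [hrate, div_mul_eq_mul_div, mul_div_assoc, Real.div_sqrt]
  have hpos : 0 < deviationRate q c := by
    rw [hrate]
    positivity
  rw [← hmul]
  refine le_of_mul_le_mul_left ?_ hpos
  calc deviationRate q c * d ≤ 2 * (deviationRate q c ^ 2 * c) := by linarith
    _ = deviationRate q c * (2 * (deviationRate q c * c)) := by ring

theorem le_sq_sqrt_add_sqrt_of_deviationRate_mul_lt (hq : 0 < q) (hc : 0 ≤ c)
    (hd : deviationRate q c * (e - c) - deviationRate q c ^ 2 * c < 2 * q) :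
    e ≤ (√c + √(2 * q)) ^ 2 := by
  rw [add_sq, Real.sq_sqrt hc, Real.sq_sqrt (by positivity)]
  rcases le_or_gt c (2 * q) with hcq | hcq
  · rw [deviationRate, if_pos hcq] at hd
    linarith [le_sqrt_mul_sqrt hc hcq]
  · linarith [le_two_mul_of_deviationRate_mul_lt hq hcq hd]

theorem le_add_of_neg_deviationRate_mul_lt (hq : 0 < q) (hc : 0 ≤ c) (he : 0 ≤ e)
    (hd : -deviationRate q c * (e - c) - (-deviationRate q c) ^ 2 * c < 2 * q) :
    c ≤ e + 2 * (√(2 * q) * √c) := by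
  rcases le_or_gt c (2 * q) with hcq | hcq
  · have hnonneg : 0 ≤ √(2 * q) * √c := by positivity
    linarith [le_sqrt_mul_sqrt hc hcq]
  · rw [neg_mul, ← mul_neg, neg_sub, neg_sq] at hd
    linarith [le_two_mul_of_deviationRate_mul_lt hq hcq hd]

theorem sqrt_two_mul_le (q : ℝ) : √(2 * q) ≤ 10 / 7 * √q := by
  rw [Real.sqrt_mul zero_le_two]
  gcongr
  exact Real.sqrt_le_iff.mpr (by norm_num)

theorem le_bernstein_upper (hq : 0 ≤ q) (hc : 0 ≤ c) (he : 0 ≤ e)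
    (h : c ≤ e + 2 * (√(2 * q) * √c)) : c ≤ e + 4 * √(e * q) + 8 * q := by
  have hsq : √(2 * q) ^ 2 = 2 * q := Real.sq_sqrt (by positivity)
  have hroot : √c ≤ √e + 2 * √(2 * q) := by
    have hcomplete : (√c - √(2 * q)) ^ 2 ≤ (√e + √(2 * q)) ^ 2 := by
      rw [sub_sq, add_sq, hsq, Real.sq_sqrt hc, Real.sq_sqrt he]
      linarith [mul_nonneg (Real.sqrt_nonneg e) (Real.sqrt_nonneg (2 * q))]
    linarith [(abs_le_of_sq_le_sq' hcomplete (by positivity)).2]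
  calc c ≤ e + 2 * (√(2 * q) * (√e + 2 * √(2 * q))) := h.trans (by gcongr)
    _ = e + 2 * (√e * √(2 * q)) + 8 * q := by linear_combination 4 * hsq
    _ ≤ e + 4 * √(e * q) + 8 * q := by
        rw [Real.sqrt_mul he]
        linarith [mul_le_mul_of_nonneg_left (sqrt_two_mul_le q) (Real.sqrt_nonneg e),
          mul_nonneg (Real.sqrt_nonneg e) (Real.sqrt_nonneg q)]

theorem bernstein_upper_le (hq : 0 ≤ q) (he : 0 ≤ e) (h : e ≤ (√c + √(2 * q)) ^ 2) :
    e + 4 * √(e * q) + 8 * q ≤ (√c + √(16 * q)) ^ 2 := by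
  have hroot : √e ≤ √c + 10 / 7 * √q := by
    calc √e ≤ √c + √(2 * q) := Real.sqrt_le_iff.mpr ⟨by positivity, h⟩
      _ ≤ √c + 10 / 7 * √q := by gcongr; exact sqrt_two_mul_le q
  have hsixteen : √(16 * q) = 4 * √q := by
    rw [Real.sqrt_mul (by norm_num), show (16 : ℝ) = 4 ^ 2 by norm_num,
      Real.sqrt_sq (by norm_num)]
  calc e + 4 * √(e * q) + 8 * q = √e ^ 2 + 4 * (√e * √q) + 8 * √q ^ 2 := by
        rw [Real.sq_sqrt he, Real.sq_sqrt hq, Real.sqrt_mul he]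
    _ ≤ (√c + 10 / 7 * √q) ^ 2 + 4 * ((√c + 10 / 7 * √q) * √q) + 8 * √q ^ 2 := by gcongr
    _ ≤ (√c + √(16 * q)) ^ 2 := by
        rw [hsixteen]
        nlinarith [mul_nonneg (Real.sqrt_nonneg c) (Real.sqrt_nonneg q), sq_nonneg √q]

end Deviation

section Confidence

variable {K N T : ℕ} {a : ℕ → Fin K} {v : ℕ → Fin K → Fin N → ℝ} {t : ℕ} {i : Fin K} {n : Fin N}

/-- The confidence exponent `log (N K T²)` of the algorithm. -/
noncomputable def confidenceParam (N K T : ℕ) : ℝ :=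
  Real.log (N * K * T ^ 2)

/-- The logarithm of the test martingale with tilt `lam` for the hypothesis that the utilities of
agent `n` for arm `i` have mean `c`. For `|lam| ≤ 1` its exponential is a supermartingale. -/
noncomputable def logWealth (lam c : ℝ) (a : ℕ → Fin K) (v : ℕ → Fin K → Fin N → ℝ) (t : ℕ)
    (i : Fin K) (n : Fin N) : ℝ :=
  ∑ τ ∈ Finset.Icc 1 t, if a τ = i then lam * (v τ i n - c) - lam ^ 2 * c else 0

/-- The square of the confidence radius on the square-root scale: with high probability
`√(upperConfidence … i n) ≤ √(u i n) + √(sqWidth … i)`. The maximum with `1` covers arms which have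
not been selected yet. -/
noncomputable def sqWidth (L : ℝ) (a : ℕ → Fin K) (t : ℕ) (i : Fin K) : ℝ :=
  16 * L / max (pullCount a t i : ℝ) 1

theorem logWealth_succ (lam c : ℝ) (a : ℕ → Fin K) (v : ℕ → Fin K → Fin N → ℝ) (t : ℕ) (i : Fin K)
    (n : Fin N) :
    logWealth lam c a v (t + 1) i n = logWealth lam c a v t i n
      + if a (t + 1) = i then lam * (v (t + 1) i n - c) - lam ^ 2 * c else 0 :=
  Finset.sum_Icc_succ_top (by omega) _

theorem logWealth_eq_pullCount_mul (lam c : ℝ) (h : pullCount a t i ≠ 0) :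
    logWealth lam c a v t i n
      = pullCount a t i * (lam * (empiricalMean a v t i n - c) - lam ^ 2 * c) := by
  have hmean : pullCount a t i * empiricalMean a v t i n
      = ∑ τ ∈ Finset.Icc 1 t, if a τ = i then v τ i n else 0 := by
    rw [empiricalMean, mul_div_cancel₀ _ (Nat.cast_ne_zero.mpr h)]
  have hcount : (pullCount a t i : ℝ) = ∑ τ ∈ Finset.Icc 1 t, if a τ = i then 1 else 0 := by
    exact_mod_cast pullCount_eq_sum a t i
  calc logWealth lam c a v t i n
      = lam * (∑ τ ∈ Finset.Icc 1 t, if a τ = i then v τ i n else 0)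
        - (lam * c + lam ^ 2 * c) * ∑ τ ∈ Finset.Icc 1 t, if a τ = i then 1 else 0 := by
        rw [logWealth, Finset.mul_sum, Finset.mul_sum, ← Finset.sum_sub_distrib]
        refine Finset.sum_congr rfl fun τ _ => ?_
        split_ifs <;> ring
    _ = _ := by
        rw [← hmean, ← hcount]
        ring

theorem mul_sub_lt_of_logWealth_lt {lam c L : ℝ} (hs : pullCount a t i ≠ 0)
    (h : logWealth lam c a v t i n < 2 * L) :
    lam * (empiricalMean a v t i n - c) - lam ^ 2 * c < 2 * (L / pullCount a t i) := by
  have hpos : (0 : ℝ) < pullCount a t i := by exact_mod_cast Nat.pos_of_ne_zero hs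
  rwa [← mul_div_assoc, lt_div_iff₀' hpos, ← logWealth_eq_pullCount_mul lam c hs]

theorem empiricalMean_nonneg (hv : ∀ s < t, ∀ i n, 0 ≤ v (s + 1) i n) (i : Fin K) (n : Fin N) :
    0 ≤ empiricalMean a v t i n := by
  refine div_nonneg (Finset.sum_nonneg fun τ hτ => ?_) (Nat.cast_nonneg _)
  obtain ⟨hτ1, hτt⟩ := Finset.mem_Icc.mp hτ
  obtain ⟨s, rfl⟩ := Nat.exists_eq_add_of_le' hτ1
  split_ifs
  exacts [hv s (by omega) i n, le_rfl]

theorem upperConfidence_of_pullCount_ne_zero (hs : pullCount a t i ≠ 0) :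
    upperConfidence T a v t i n = empiricalMean a v t i n
      + 4 * √(empiricalMean a v t i n * (confidenceParam N K T / pullCount a t i))
      + 8 * (confidenceParam N K T / pullCount a t i) := by
  rw [upperConfidence, if_neg hs, confidenceParam, mul_div_assoc, mul_div_assoc]

theorem upperConfidence_mem_Icc {c : ℝ} (hL : 1 / 16 ≤ confidenceParam N K T)
    (hc : c ∈ Set.Icc (0 : ℝ) 1) (hv : ∀ s < t, ∀ i n, 0 ≤ v (s + 1) i n)
    (hdev : ∀ σ : ℤˣ, logWealth
      ((σ : ℤ) * deviationRate (confidenceParam N K T / pullCount a t i) c) c a v t i n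
        < 2 * confidenceParam N K T) :
    upperConfidence T a v t i n
      ∈ Set.Icc c ((√c + √(sqWidth (confidenceParam N K T) a t i)) ^ 2) := by
  rcases eq_or_ne (pullCount a t i) 0 with hs | hs
  · rw [upperConfidence, if_pos hs, sqWidth, hs]
    refine ⟨hc.2, one_le_pow₀ ?_⟩
    have hroot : 1 ≤ √(16 * confidenceParam N K T / max ((0 : ℕ) : ℝ) 1) := by
      rw [Real.one_le_sqrt, Nat.cast_zero, max_eq_right zero_le_one]
      linarith
    linarith [Real.sqrt_nonneg c]
  · have hone : (1 : ℝ) ≤ pullCount a t i := by exact_mod_cast Nat.one_le_iff_ne_zero.mpr hs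
    have hq : 0 < confidenceParam N K T / pullCount a t i := by positivity
    have he : 0 ≤ empiricalMean a v t i n := empiricalMean_nonneg hv i n
    have hpos := mul_sub_lt_of_logWealth_lt hs (hdev 1)
    have hneg := mul_sub_lt_of_logWealth_lt hs (hdev (-1))
    simp only [Units.val_one, Int.cast_one, one_mul, Units.val_neg, Int.cast_neg, neg_mul]
      at hpos hneg
    rw [upperConfidence_of_pullCount_ne_zero hs, sqWidth, max_eq_left hone, mul_div_assoc]
    exact ⟨le_bernstein_upper hq.le hc.1 he
        (le_add_of_neg_deviationRate_mul_lt hq hc.1 he (by simpa only [neg_mul] using hneg)),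
      bernstein_upper_le hq.le he
        (le_sq_sqrt_add_sqrt_of_deviationRate_mul_lt hq hc.1 hpos)⟩

end Confidence

/-! ### Concentration -/

section Concentration

variable {Ω : Type*} {mΩ : MeasurableSpace Ω} {μ : Measure Ω}

theorem exp_mul_le_one_add {lam y : ℝ} (hlam : |lam| ≤ 1) (hy : y ∈ Set.Icc (0 : ℝ) 1) :
    Real.exp (lam * y) ≤ 1 + (lam + lam ^ 2) * y := by
  have habs : |lam * y| ≤ 1 := by
    rw [abs_mul, abs_of_nonneg hy.1]
    exact mul_le_one₀ hlam hy.1 hy.2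
  have hsq : (lam * y) ^ 2 ≤ lam ^ 2 * y := by
    rw [mul_pow]
    gcongr
    exact pow_le_of_le_one hy.1 hy.2 two_ne_zero
  linarith [(abs_le.mp (Real.abs_exp_sub_one_sub_id_le habs)).2]

theorem mgf_le_exp_of_mem_Icc [IsProbabilityMeasure μ] {X : Ω → ℝ} (hX : Measurable X)
    (h01 : ∀ᵐ ω ∂μ, X ω ∈ Set.Icc (0 : ℝ) 1) {lam : ℝ} (hlam : |lam| ≤ 1) :
    mgf X μ lam ≤ Real.exp ((lam + lam ^ 2) * μ[X]) := by
  have hint : Integrable X μ := .of_mem_Icc 0 1 hX.aemeasurable h01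
  calc mgf X μ lam ≤ ∫ ω, (1 + (lam + lam ^ 2) * X ω) ∂μ :=
        integral_mono_ae (integrable_exp_mul_of_mem_Icc hX.aemeasurable h01)
          ((integrable_const 1).add (hint.const_mul _))
          (h01.mono fun ω hω => exp_mul_le_one_add hlam hω)
    _ = (lam + lam ^ 2) * μ[X] + 1 := by
        rw [integral_add (integrable_const 1) (hint.const_mul _), integral_const_mul,
          integral_const, probReal_univ, one_smul, add_comm]
    _ ≤ Real.exp ((lam + lam ^ 2) * μ[X]) := Real.add_one_le_exp _

theorem lintegral_exp_deviation_le_one [IsProbabilityMeasure μ] {X : Ω → ℝ} (hX : Measurable X)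
    (h01 : ∀ᵐ ω ∂μ, X ω ∈ Set.Icc (0 : ℝ) 1) {lam : ℝ} (hlam : |lam| ≤ 1) :
    ∫⁻ ω, ENNReal.ofReal (Real.exp (lam * (X ω - μ[X]) - lam ^ 2 * μ[X])) ∂μ ≤ 1 := by
  have hsplit (ω : Ω) : Real.exp (lam * (X ω - μ[X]) - lam ^ 2 * μ[X])
      = Real.exp (lam * X ω) * Real.exp (-((lam + lam ^ 2) * μ[X])) := by
    rw [← Real.exp_add]
    ring_nf
  simp only [hsplit]
  rw [← ofReal_integral_eq_lintegral_ofReal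
    ((integrable_exp_mul_of_mem_Icc hX.aemeasurable h01).mul_const _)
    (.of_forall fun ω => by positivity), ENNReal.ofReal_le_one, integral_mul_const, Real.exp_neg,
    ← div_eq_mul_inv, div_le_one (Real.exp_pos _)]
  exact mgf_le_exp_of_mem_Icc hX h01 hlam

theorem lintegral_piecewise_mul_le {α : Type*} {m m' m0 : MeasurableSpace α} {μ : Measure α}
    (hm : m ≤ m0) (hm' : m' ≤ m0) (hind : Indep m m' μ) {A : Set α} [DecidablePred (· ∈ A)]
    (hA : MeasurableSet[m] A) {M Z : α → ENNReal} (hM : Measurable[m] M) (hZ : Measurable[m'] Z)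
    (hZ1 : ∫⁻ x, Z x ∂μ ≤ 1) :
    ∫⁻ x, A.piecewise (fun x => M x * Z x) M x ∂μ ≤ ∫⁻ x, M x ∂μ := by
  have hA' : MeasurableSet A := hm A hA
  have hprod : ∫⁻ x in A, M x * Z x ∂μ = (∫⁻ x in A, M x ∂μ) * ∫⁻ x, Z x ∂μ := by
    rw [← lintegral_indicator hA', ← lintegral_indicator hA',
      ← lintegral_mul_eq_lintegral_mul_lintegral_of_independent_measurableSpace hm hm' hind
        (hM.indicator hA) hZ]
    simp only [Set.indicator_mul_left]
  calc _ = (∫⁻ x in A, M x ∂μ) * ∫⁻ x, Z x ∂μ + ∫⁻ x in Aᶜ, M x ∂μ := by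
        rw [MeasureTheory.lintegral_piecewise hA', hprod]
    _ ≤ ∫⁻ x in A, M x ∂μ + ∫⁻ x in Aᶜ, M x ∂μ := by
        gcongr
        exact mul_le_of_le_one_right zero_le hZ1
    _ = ∫⁻ x, M x ∂μ := lintegral_add_compl M hA'

end Concentration

section Interaction

variable {Ω : Type*} {mΩ : MeasurableSpace Ω} {K N T : ℕ} {ν : Measure (Fin K → Fin N → ℝ)}
  {μ : Measure Ω} {ℱ : Filtration ℕ mΩ} {U : ℕ → Ω → Fin K → Fin N → ℝ}
  {p : ℕ → Ω → Fin K → ℝ} {I : ℕ → Ω → Fin K} {t : ℕ}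

theorem measurable_utility_entry (i : Fin K) (n : Fin N) :
    Measurable fun v : Fin K → Fin N → ℝ => v i n :=
  (measurable_pi_apply n).comp (measurable_pi_apply i)

theorem meanUtility_mem_Icc [IsProbabilityMeasure ν]
    (hν : ∀ᵐ v ∂ν, ∀ i n, v i n ∈ Set.Icc (0 : ℝ) 1) (i : Fin K) (n : Fin N) :
    meanUtility ν i n ∈ Set.Icc (0 : ℝ) 1 :=
  have h01 : ∀ᵐ v ∂ν, v i n ∈ Set.Icc (0 : ℝ) 1 := hν.mono fun _ hv => hv i n
  (convex_Icc 0 1).integral_mem isClosed_Icc h01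
    (.of_mem_Icc 0 1 (measurable_utility_entry i n).aemeasurable h01)

namespace IsBanditInteraction

theorem measurable_arm (h : IsBanditInteraction T ν μ ℱ U p I) (ht : t < T) :
    Measurable (I (t + 1)) :=
  (h.arm_measurable t ht).mono (ℱ.le _) le_rfl

theorem measurable_strategy (h : IsBanditInteraction T ν μ ℱ U p I) (ht : t < T) :
    Measurable (p (t + 1)) :=
  (h.strategy_measurable t ht).mono (ℱ.le t) le_rfl

theorem measurable_utility_of_mem_Icc (h : IsBanditInteraction T ν μ ℱ U p I) {τ : ℕ}
    (hτ : τ ∈ Finset.Icc 1 t) (ht : t ≤ T) : Measurable[ℱ t] (U τ) := by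
  obtain ⟨hτ1, hτt⟩ := Finset.mem_Icc.mp hτ
  obtain ⟨s, rfl⟩ := Nat.exists_eq_add_of_le' hτ1
  exact (h.utility_measurable s (by omega)).mono (ℱ.mono hτt) le_rfl

theorem measurableSet_arm_eq (h : IsBanditInteraction T ν μ ℱ U p I) {τ : ℕ}
    (hτ : τ ∈ Finset.Icc 1 t) (ht : t ≤ T) (i : Fin K) : MeasurableSet[ℱ t] {ω | I τ ω = i} := by
  obtain ⟨hτ1, hτt⟩ := Finset.mem_Icc.mp hτ
  obtain ⟨s, rfl⟩ := Nat.exists_eq_add_of_le' hτ1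
  exact ℱ.mono hτt _ (h.arm_measurable s (by omega) (measurableSet_singleton i))

theorem measurable_pullCount (h : IsBanditInteraction T ν μ ℱ U p I) (ht : t ≤ T) (i : Fin K) :
    Measurable[ℱ t] fun ω => pullCount (I · ω) t i := by
  simp only [pullCount_eq_sum]
  exact Finset.measurable_sum _ fun τ hτ =>
    Measurable.ite (h.measurableSet_arm_eq hτ ht i) measurable_const measurable_const

theorem measurable_logWealth (h : IsBanditInteraction T ν μ ℱ U p I) (ht : t ≤ T) (lam c : ℝ)
    (i : Fin K) (n : Fin N) :
    Measurable[ℱ t] fun ω => logWealth lam c (I · ω) (U · ω) t i n := by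
  unfold logWealth
  refine Finset.measurable_sum _ fun τ hτ => ?_
  have hU : Measurable[ℱ t] fun ω => U τ ω i n :=
    (measurable_utility_entry i n).comp (h.measurable_utility_of_mem_Icc hτ ht)
  exact Measurable.ite (h.measurableSet_arm_eq hτ ht i)
    (((hU.sub_const c).const_mul lam).sub_const _) measurable_const

theorem ae_utility_mem_Icc (h : IsBanditInteraction T ν μ ℱ U p I)
    (hν : ∀ᵐ v ∂ν, ∀ i n, v i n ∈ Set.Icc (0 : ℝ) 1) :
    ∀ᵐ ω ∂μ, ∀ t < T, ∀ i n, U (t + 1) ω i n ∈ Set.Icc (0 : ℝ) 1 := by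
  refine ae_all_iff.mpr fun t => Filter.eventually_imp_distrib_left.mpr fun ht => ?_
  have hlaw := h.utility_law t ht
  exact ae_of_ae_map hlaw.aemeasurable (hlaw.map_eq ▸ hν)

theorem lintegral_exp_logWealth_succ_le [IsProbabilityMeasure ν]
    (h : IsBanditInteraction T ν μ ℱ U p I) (hν : ∀ᵐ v ∂ν, ∀ i n, v i n ∈ Set.Icc (0 : ℝ) 1)
    {lam : ℝ} (hlam : |lam| ≤ 1) (i : Fin K) (n : Fin N) (ht : t < T) :
    ∫⁻ ω, ENNReal.ofReal (Real.exp
        (logWealth lam (meanUtility ν i n) (I · ω) (U · ω) (t + 1) i n)) ∂μ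
      ≤ ∫⁻ ω, ENNReal.ofReal (Real.exp
        (logWealth lam (meanUtility ν i n) (I · ω) (U · ω) t i n)) ∂μ := by
  set c := meanUtility ν i n
  let A : Set Ω := {ω | I (t + 1) ω = i}
  let M (ω : Ω) : ENNReal := .ofReal (Real.exp (logWealth lam c (I · ω) (U · ω) t i n))
  let ψ (v : Fin K → Fin N → ℝ) : ENNReal := .ofReal (Real.exp (lam * (v i n - c) - lam ^ 2 * c))
  have hψ : Measurable ψ :=
    ((((measurable_utility_entry i n).sub_const c).const_mul lam).sub_const _).exp.ennreal_ofReal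
  have hψ1 : ∫⁻ ω, ψ (U (t + 1) ω) ∂μ ≤ 1 := by
    rw [(h.utility_law t ht).lintegral_comp hψ.aemeasurable]
    exact lintegral_exp_deviation_le_one (measurable_utility_entry i n)
      (hν.mono fun v hv => hv i n) hlam
  have hstep (ω : Ω) :
      ENNReal.ofReal (Real.exp (logWealth lam c (I · ω) (U · ω) (t + 1) i n))
        = A.piecewise (fun ω => M ω * ψ (U (t + 1) ω)) M ω := by
    by_cases hω : I (t + 1) ω = i
    · rw [Set.piecewise_eq_of_mem _ _ _ (show ω ∈ A from hω), logWealth_succ, if_pos hω,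
        Real.exp_add, ENNReal.ofReal_mul (Real.exp_pos _).le]
    · rw [Set.piecewise_eq_of_notMem _ _ _ (show ω ∉ A from hω), logWealth_succ, if_neg hω,
        add_zero]
  have hM : Measurable[ℱ t ⊔ MeasurableSpace.comap (I (t + 1)) inferInstance] M :=
    (h.measurable_logWealth ht.le lam c i n).exp.ennreal_ofReal.mono le_sup_left le_rfl
  have hA : MeasurableSet[ℱ t ⊔ MeasurableSpace.comap (I (t + 1)) inferInstance] A :=
    (le_sup_right : MeasurableSpace.comap (I (t + 1)) inferInstance ≤ _) _
      ⟨{i}, measurableSet_singleton i, rfl⟩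
  simp only [hstep]
  exact lintegral_piecewise_mul_le (sup_le (ℱ.le t) (h.measurable_arm ht).comap_le)
    ((h.utility_measurable t ht).mono (ℱ.le _) le_rfl).comap_le (h.utility_indep t ht).symm hA hM
    (hψ.comp (comap_measurable (U (t + 1)))) hψ1

theorem lintegral_exp_logWealth_le_one [IsProbabilityMeasure ν] [IsProbabilityMeasure μ]
    (h : IsBanditInteraction T ν μ ℱ U p I) (hν : ∀ᵐ v ∂ν, ∀ i n, v i n ∈ Set.Icc (0 : ℝ) 1)
    {lam : ℝ} (hlam : |lam| ≤ 1) (i : Fin K) (n : Fin N) (ht : t ≤ T) :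
    ∫⁻ ω, ENNReal.ofReal (Real.exp
      (logWealth lam (meanUtility ν i n) (I · ω) (U · ω) t i n)) ∂μ ≤ 1 := by
  induction t with
  | zero => simp [logWealth]
  | succ t ih =>
    exact (h.lintegral_exp_logWealth_succ_le hν hlam i n ht).trans (ih (Nat.le_of_succ_le ht))

theorem measureReal_le_logWealth_le [IsProbabilityMeasure ν] [IsProbabilityMeasure μ]
    (h : IsBanditInteraction T ν μ ℱ U p I) (hν : ∀ᵐ v ∂ν, ∀ i n, v i n ∈ Set.Icc (0 : ℝ) 1)
    {lam : ℝ} (hlam : |lam| ≤ 1) (i : Fin K) (n : Fin N) (ht : t ≤ T) (x : ℝ) :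
    μ.real {ω | x ≤ logWealth lam (meanUtility ν i n) (I · ω) (U · ω) t i n}
      ≤ Real.exp (-x) := by
  set Z := fun ω => logWealth lam (meanUtility ν i n) (I · ω) (U · ω) t i n
  have hZ : Measurable Z :=
    (h.measurable_logWealth ht lam (meanUtility ν i n) i n).mono (ℱ.le t) le_rfl
  have hmarkov : ENNReal.ofReal (Real.exp x) * μ {ω | x ≤ Z ω} ≤ 1 := by
    have hevent : {ω | x ≤ Z ω}
        = {ω | ENNReal.ofReal (Real.exp x) ≤ ENNReal.ofReal (Real.exp (Z ω))} := by
      simp only [ENNReal.ofReal_le_ofReal_iff (Real.exp_pos _).le, Real.exp_le_exp]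
    rw [hevent]
    exact (mul_meas_ge_le_lintegral₀ hZ.exp.ennreal_ofReal.aemeasurable _).trans
      (h.lintegral_exp_logWealth_le_one hν hlam i n ht)
  have hreal := ENNReal.toReal_mono ENNReal.one_ne_top hmarkov
  rw [ENNReal.toReal_mul, ENNReal.toReal_ofReal (Real.exp_pos _).le, ENNReal.toReal_one] at hreal
  rwa [Real.exp_neg, ← one_div, le_div_iff₀' (Real.exp_pos _)]

end IsBanditInteraction

/-- The event that after `t` rounds some test martingale has grown to `exp (2 * L)`. Each tilt is
tuned to a number `s ≤ T` of samples which is fixed in advance, as the actual number of samples is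
random; the sign `σ` distinguishes the two tails. -/
def deviationEvent (L : ℝ) (T : ℕ) (u : Fin K → Fin N → ℝ) (U : ℕ → Ω → Fin K → Fin N → ℝ)
    (I : ℕ → Ω → Fin K) (t : ℕ) : Set Ω :=
  ⋃ (i : Fin K) (n : Fin N) (s : Fin (T + 1)) (σ : ℤˣ),
    {ω | 2 * L ≤ logWealth ((σ : ℤ) * deviationRate (L / (s : ℕ)) (u i n)) (u i n) (I · ω) (U · ω)
      t i n}

theorem logWealth_lt_of_notMem_deviationEvent {L : ℝ} {u : Fin K → Fin N → ℝ} {ω : Ω}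
    (hω : ω ∉ deviationEvent L T u U I t) (i : Fin K) (n : Fin N) {s : ℕ} (hs : s ≤ T) (σ : ℤˣ) :
    logWealth ((σ : ℤ) * deviationRate (L / s) (u i n)) (u i n) (I · ω) (U · ω) t i n < 2 * L := by
  simp only [deviationEvent, Set.mem_iUnion, Set.mem_ofPred_eq, not_exists, not_le] at hω
  exact hω i n ⟨s, Nat.lt_succ_of_le hs⟩ σ

theorem abs_intUnits_mul (σ : ℤˣ) (x : ℝ) : |(σ : ℤ) * x| = |x| := by
  rcases Int.units_eq_one_or σ with rfl | rfl <;> simp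

theorem upperConfidence_mem_Icc_of_notMem_deviationEvent {u : Fin K → Fin N → ℝ} {ω : Ω}
    (hL : 1 / 16 ≤ confidenceParam N K T) (hu : ∀ i n, u i n ∈ Set.Icc (0 : ℝ) 1) (ht : t ≤ T)
    (hU : ∀ s < t, ∀ i n, 0 ≤ U (s + 1) ω i n)
    (hω : ω ∉ deviationEvent (confidenceParam N K T) T u U I t) (i : Fin K) (n : Fin N) :
    upperConfidence T (I · ω) (U · ω) t i n
      ∈ Set.Icc (u i n) ((√(u i n) + √(sqWidth (confidenceParam N K T) (I · ω) t i)) ^ 2) :=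
  upperConfidence_mem_Icc hL (hu i n) hU fun σ =>
    logWealth_lt_of_notMem_deviationEvent hω i n ((pullCount_le (I · ω) t i).trans ht) σ

namespace IsBanditInteraction

theorem measurableSet_deviationEvent (h : IsBanditInteraction T ν μ ℱ U p I) (ht : t ≤ T) (L : ℝ)
    (u : Fin K → Fin N → ℝ) : MeasurableSet (deviationEvent L T u U I t) := by
  refine .iUnion fun i => .iUnion fun n => .iUnion fun s => .iUnion fun σ => ?_
  exact measurableSet_le measurable_const
    ((h.measurable_logWealth ht _ _ _ _).mono (ℱ.le t) le_rfl)

theorem measureReal_deviationEvent_le [IsProbabilityMeasure ν] [IsProbabilityMeasure μ]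
    (h : IsBanditInteraction T ν μ ℱ U p I) (hν : ∀ᵐ v ∂ν, ∀ i n, v i n ∈ Set.Icc (0 : ℝ) 1)
    {L : ℝ} (hL : 0 ≤ L) (ht : t ≤ T) :
    μ.real (deviationEvent L T (meanUtility ν) U I t)
      ≤ K * (N * ((T + 1) * (2 * Real.exp (-(2 * L))))) := by
  have union_le {m : ℕ} {A : Fin m → Set Ω} {b : ℝ} (hA : ∀ i, μ.real (A i) ≤ b) :
      μ.real (⋃ i, A i) ≤ m * b := by
    simpa using (measureReal_iUnion_fintype_le A).trans
      (Finset.sum_le_card_nsmul Finset.univ _ b fun i _ => hA i)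
  refine union_le fun i => union_le fun n => ?_
  rw [← Nat.cast_succ]
  refine union_le fun s => ?_
  calc _ ≤ ∑ _σ : ℤˣ, Real.exp (-(2 * L)) := by
        refine (measureReal_iUnion_fintype_le _).trans (Finset.sum_le_sum fun σ _ => ?_)
        refine h.measureReal_le_logWealth_le hν ?_ i n ht _
        rw [abs_intUnits_mul]
        exact abs_deviationRate_le_one (by positivity)
    _ = 2 * Real.exp (-(2 * L)) := by simp

theorem measureReal_deviationEvent_confidenceParam_le [IsProbabilityMeasure ν]
    [IsProbabilityMeasure μ] (h : IsBanditInteraction T ν μ ℱ U p I)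
    (hν : ∀ᵐ v ∂ν, ∀ i n, v i n ∈ Set.Icc (0 : ℝ) 1) (hN : 0 < N) (hK : 0 < K) (hT : 0 < T)
    (ht : t ≤ T) :
    μ.real (deviationEvent (confidenceParam N K T) T (meanUtility ν) U I t) ≤ 4 / T := by
  have hN1 : (1 : ℝ) ≤ N := by exact_mod_cast hN
  have hK1 : (1 : ℝ) ≤ K := by exact_mod_cast hK
  have hT1 : (1 : ℝ) ≤ T := by exact_mod_cast hT
  have hx1 : (1 : ℝ) ≤ N * K * T ^ 2 := one_le_mul_of_one_le_of_one_le
    (one_le_mul_of_one_le_of_one_le hN1 hK1) (one_le_pow₀ hT1)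
  have hexp : Real.exp (-(2 * confidenceParam N K T)) = 1 / ((N : ℝ) * K * T ^ 2) ^ 2 := by
    rw [Real.exp_neg, two_mul, Real.exp_add, confidenceParam, Real.exp_log (by positivity), one_div,
      ← sq]
  calc _ ≤ K * (N * ((T + 1) * (2 * Real.exp (-(2 * confidenceParam N K T))))) :=
        h.measureReal_deviationEvent_le hν (Real.log_nonneg hx1) ht
    _ ≤ K * (N * (2 * T * (2 * (1 / ((N : ℝ) * K * T ^ 2) ^ 2)))) := by
        rw [hexp]
        gcongr
        linarith
    _ = 4 / T * (1 / (N * K * T ^ 2)) := by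
        field_simp
        norm_num
    _ ≤ 4 / T := mul_le_of_le_one_right (by positivity) ((div_le_one (by positivity)).mpr hx1)

/-! ### Expected regret of a round -/

theorem integrable_indicator_arm [IsFiniteMeasure μ] (h : IsBanditInteraction T ν μ ℱ U p I)
    (ht : t < T) {f : Ω → ℝ} (hf : Measurable[ℱ t] f) {b : ℝ} (hb : ∀ ω, |f ω| ≤ b) (i : Fin K) :
    Integrable ({ω | I (t + 1) ω = i}.indicator f) μ :=
  (Integrable.of_bound (hf.mono (ℱ.le t) le_rfl).aestronglyMeasurable b (.of_forall hb)).indicator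
    (h.measurable_arm ht (measurableSet_singleton i))

theorem condExp_indicator_arm [IsFiniteMeasure μ] (h : IsBanditInteraction T ν μ ℱ U p I)
    (ht : t < T) {f : Ω → ℝ} (hf : Measurable[ℱ t] f) {b : ℝ} (hb : ∀ ω, |f ω| ≤ b) (i : Fin K) :
    μ[{ω | I (t + 1) ω = i}.indicator f | ℱ t] =ᵐ[μ] fun ω => p (t + 1) ω i * f ω := by
  have hone : Integrable ({ω | I (t + 1) ω = i}.indicator fun _ => (1 : ℝ)) μ :=
    (integrable_const 1).indicator (h.measurable_arm ht (measurableSet_singleton i))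
  have hmul : {ω | I (t + 1) ω = i}.indicator f
      = f * {ω | I (t + 1) ω = i}.indicator fun _ => (1 : ℝ) := by
    ext ω
    simp [Set.indicator_apply]
  rw [hmul]
  filter_upwards [condExp_stronglyMeasurable_mul_of_bound (ℱ.le t) hf.stronglyMeasurable hone b
    (.of_forall hb), h.arm_law t ht i] with ω hpull harm
  rw [hpull, Pi.mul_apply, harm, mul_comm]

theorem integrable_strategy_mul [IsFiniteMeasure μ] (h : IsBanditInteraction T ν μ ℱ U p I)
    (ht : t < T) {f : Ω → ℝ} (hf : Measurable[ℱ t] f) {b : ℝ} (hb : ∀ ω, |f ω| ≤ b) (i : Fin K) :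
    Integrable (fun ω => p (t + 1) ω i * f ω) μ :=
  integrable_condExp.congr (h.condExp_indicator_arm ht hf hb i)

theorem integral_strategy_mul [IsFiniteMeasure μ] (h : IsBanditInteraction T ν μ ℱ U p I)
    (ht : t < T) {f : Ω → ℝ} (hf : Measurable[ℱ t] f) {b : ℝ} (hb : ∀ ω, |f ω| ≤ b) (i : Fin K) :
    ∫ ω, p (t + 1) ω i * f ω ∂μ = ∫ ω, {ω | I (t + 1) ω = i}.indicator f ω ∂μ := by
  rw [← integral_congr_ae (h.condExp_indicator_arm ht hf hb i), integral_condExp (ℱ.le t)]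

theorem apply_arm_eq_sum_indicator (I : ℕ → Ω → Fin K) (t : ℕ) (g : Fin K → Ω → ℝ) (ω : Ω) :
    g (I t ω) ω = ∑ i, {ω | I t ω = i}.indicator (g i) ω := by
  simp [Set.indicator_apply]

theorem integrable_apply_arm [IsFiniteMeasure μ] (h : IsBanditInteraction T ν μ ℱ U p I)
    (ht : t < T) {g : Fin K → Ω → ℝ} (hg : ∀ i, Measurable[ℱ t] (g i)) {b : ℝ}
    (hb : ∀ i ω, |g i ω| ≤ b) : Integrable (fun ω => g (I (t + 1) ω) ω) μ := by
  simp only [apply_arm_eq_sum_indicator]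
  exact integrable_finsetSum _ fun i _ => h.integrable_indicator_arm ht (hg i) (hb i) i

theorem integrable_sum_strategy_mul [IsFiniteMeasure μ] (h : IsBanditInteraction T ν μ ℱ U p I)
    (ht : t < T) {g : Fin K → Ω → ℝ} (hg : ∀ i, Measurable[ℱ t] (g i)) {b : ℝ}
    (hb : ∀ i ω, |g i ω| ≤ b) : Integrable (fun ω => ∑ i, p (t + 1) ω i * g i ω) μ :=
  integrable_finsetSum _ fun i _ => h.integrable_strategy_mul ht (hg i) (hb i) i

theorem integral_sum_strategy_mul [IsFiniteMeasure μ] (h : IsBanditInteraction T ν μ ℱ U p I)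
    (ht : t < T) {g : Fin K → Ω → ℝ} (hg : ∀ i, Measurable[ℱ t] (g i)) {b : ℝ}
    (hb : ∀ i ω, |g i ω| ≤ b) :
    ∫ ω, ∑ i, p (t + 1) ω i * g i ω ∂μ = ∫ ω, g (I (t + 1) ω) ω ∂μ := by
  simp only [apply_arm_eq_sum_indicator]
  rw [integral_finsetSum _ fun i _ => h.integrable_strategy_mul ht (hg i) (hb i) i,
    integral_finsetSum _ fun i _ => h.integrable_indicator_arm ht (hg i) (hb i) i]
  exact Finset.sum_congr rfl fun i _ => h.integral_strategy_mul ht (hg i) (hb i) i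

end IsBanditInteraction

theorem sqWidth_nonneg {L : ℝ} (hL : 0 ≤ L) (a : ℕ → Fin K) (t : ℕ) (i : Fin K) :
    0 ≤ sqWidth L a t i := by
  unfold sqWidth
  positivity

theorem abs_sqWidth_le {L : ℝ} (hL : 0 ≤ L) (a : ℕ → Fin K) (t : ℕ) (i : Fin K) :
    |sqWidth L a t i| ≤ 16 * L := by
  rw [abs_of_nonneg (sqWidth_nonneg hL a t i)]
  exact div_le_self (by positivity) (le_max_right _ _)

theorem sum_sqWidth_le {L : ℝ} (hL : 0 ≤ L) (a : ℕ → Fin K) (T : ℕ) :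
    ∑ t ∈ Finset.range T, sqWidth L a t (a (t + 1)) ≤ 16 * L * (K * (2 + Real.log T)) := by
  calc _ = 16 * L * ∑ t ∈ Finset.range T, 1 / max (pullCount a t (a (t + 1)) : ℝ) 1 := by
        simp only [sqWidth, Finset.mul_sum, mul_one_div]
    _ ≤ _ := by
        gcongr
        exact sum_one_div_max_pullCount_le a T

theorem sum_Icc_one_eq_sum_range {M : Type*} [AddCommMonoid M] (f : ℕ → M) (T : ℕ) :
    ∑ t ∈ Finset.Icc 1 T, f t = ∑ t ∈ Finset.range T, f (t + 1) := by
  rw [Finset.range_eq_Ico, Finset.sum_Ico_add', zero_add, Finset.Ico_add_one_right_eq_Icc]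

namespace IsBanditInteraction

theorem measurable_sqWidth (h : IsBanditInteraction T ν μ ℱ U p I) (ht : t ≤ T) (L : ℝ)
    (i : Fin K) : Measurable[ℱ t] fun ω => sqWidth L (I · ω) t i :=
  (measurable_from_top (f := fun k : ℕ => 16 * L / max (k : ℝ) 1)).comp
    (h.measurable_pullCount ht i)

theorem integrable_welfare [IsFiniteMeasure μ] (h : IsBanditInteraction T ν μ ℱ U p I)
    {u : Fin K → Fin N → ℝ} (hu : ∀ i n, u i n ∈ Set.Icc (0 : ℝ) 1) (ht : t < T) :
    Integrable (fun ω => welfare u (p (t + 1) ω)) μ :=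
  .of_mem_Icc 0 1 ((measurable_welfare u).comp (h.measurable_strategy ht)).aemeasurable
    ((h.strategy_mem t ht).mono fun _ hω => welfare_mem_Icc hu hω)

theorem welfare_sub_integral_le_one (h : IsBanditInteraction T ν μ ℱ U p I)
    {u : Fin K → Fin N → ℝ} (hu : ∀ i n, u i n ∈ Set.Icc (0 : ℝ) 1) {q : Fin K → ℝ}
    (hq : q ∈ stdSimplex ℝ (Fin K)) (ht : t < T) :
    welfare u q - ∫ ω, welfare u (p (t + 1) ω) ∂μ ≤ 1 := by
  have hle : welfare u q ≤ 1 := (welfare_mem_Icc hu hq).2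
  have hnonneg : 0 ≤ ∫ ω, welfare u (p (t + 1) ω) ∂μ :=
    integral_nonneg_of_ae ((h.strategy_mem t ht).mono fun _ hω => (welfare_mem_Icc hu hω).1)
  linarith

theorem ae_welfare_sub_le (h : IsBanditInteraction T ν μ ℱ U p I)
    (hν : ∀ᵐ v ∂ν, ∀ i n, v i n ∈ Set.Icc (0 : ℝ) 1) (hN : 2 ≤ N)
    (hL : 1 / 16 ≤ confidenceParam N K T) {u : Fin K → Fin N → ℝ}
    (hu : ∀ i n, u i n ∈ Set.Icc (0 : ℝ) 1) (ht : t < T)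
    (hmax : ∀ᵐ ω ∂μ, IsMaxOn (welfare (upperConfidence T (I · ω) (U · ω) t))
      (stdSimplex ℝ (Fin K)) (p (t + 1) ω))
    {q : Fin K → ℝ} (hq : q ∈ stdSimplex ℝ (Fin K)) {a : ℝ} (ha : 0 < a) :
    ∀ᵐ ω ∂μ, welfare u q - welfare u (p (t + 1) ω)
      ≤ (deviationEvent (confidenceParam N K T) T u U I t).indicator 1 ω
        + 16 * (a ^ (1 / (N : ℝ)) + (a ^ (1 / (N : ℝ) - 1) + 1)
          * ∑ i, p (t + 1) ω i * sqWidth (confidenceParam N K T) (I · ω) t i) := by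
  filter_upwards [hmax, h.strategy_mem t ht, h.ae_utility_mem_Icc hν] with ω hopt hp hU
  have hg (i : Fin K) : 0 ≤ sqWidth (confidenceParam N K T) (I · ω) t i :=
    sqWidth_nonneg (by linarith) _ t i
  by_cases hω : ω ∈ deviationEvent (confidenceParam N K T) T u U I t
  · have hwidth : 0 ≤ ∑ i, p (t + 1) ω i * sqWidth (confidenceParam N K T) (I · ω) t i :=
      Finset.sum_nonneg fun i _ => mul_nonneg (hp.1 i) (hg i)
    rw [Set.indicator_of_mem hω, Pi.one_apply]
    exact (sub_le_self _ (welfare_mem_Icc hu hp).1).trans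
      ((welfare_mem_Icc hu hq).2.trans (le_add_of_nonneg_right (by positivity)))
  · have hconf := upperConfidence_mem_Icc_of_notMem_deviationEvent hL hu ht.le
      (fun s hs i n => (hU s (hs.trans ht) i n).1) hω
    rw [Set.indicator_of_notMem hω, zero_add]
    exact welfare_sub_le_of_isMaxOn hN hu (fun i n => (hconf i n).1) hg
      (fun i n => (hconf i n).2) hp hq hopt ha

theorem welfare_sub_integral_le [IsProbabilityMeasure ν] [IsProbabilityMeasure μ]
    (h : IsBanditInteraction T ν μ ℱ U p I) (hν : ∀ᵐ v ∂ν, ∀ i n, v i n ∈ Set.Icc (0 : ℝ) 1)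
    (hN : 2 ≤ N) (hK : 0 < K) (hL : 1 / 16 ≤ confidenceParam N K T) (ht : t < T)
    (hmax : ∀ᵐ ω ∂μ, IsMaxOn (welfare (upperConfidence T (I · ω) (U · ω) t))
      (stdSimplex ℝ (Fin K)) (p (t + 1) ω))
    {q : Fin K → ℝ} (hq : q ∈ stdSimplex ℝ (Fin K)) {a : ℝ} (ha : 0 < a) :
    welfare (meanUtility ν) q - ∫ ω, welfare (meanUtility ν) (p (t + 1) ω) ∂μ
      ≤ 4 / T + 16 * (a ^ (1 / (N : ℝ)) + (a ^ (1 / (N : ℝ) - 1) + 1)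
        * ∫ ω, sqWidth (confidenceParam N K T) (I · ω) t (I (t + 1) ω) ∂μ) := by
  have hL0 : 0 ≤ confidenceParam N K T := by linarith
  have hwelfare : Integrable (fun ω => welfare (meanUtility ν) (p (t + 1) ω)) μ :=
    h.integrable_welfare (meanUtility_mem_Icc hν) ht
  have hmeas (i : Fin K) := h.measurable_sqWidth ht.le (confidenceParam N K T) i
  have hbound (i : Fin K) (ω : Ω) := abs_sqWidth_le hL0 (I · ω) t i
  have hwidth := h.integrable_sum_strategy_mul ht hmeas hbound
  have hevent := h.measurableSet_deviationEvent ht.le (confidenceParam N K T) (meanUtility ν)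
  have hbad := h.measureReal_deviationEvent_confidenceParam_le hν (by omega) hK (by omega) ht.le
  set B := deviationEvent (confidenceParam N K T) T (meanUtility ν) U I t
  set A : ℝ := a ^ (1 / (N : ℝ))
  set D : ℝ := a ^ (1 / (N : ℝ) - 1) + 1
  set W : Ω → ℝ := fun ω => ∑ i, p (t + 1) ω i * sqWidth (confidenceParam N K T) (I · ω) t i
  have hind : Integrable (B.indicator (1 : Ω → ℝ)) μ := (integrable_const 1).indicator hevent
  have hloss : Integrable (fun ω => A + D * W ω) μ :=
    (integrable_const A).add (hwidth.const_mul D)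
  calc _ = ∫ ω, welfare (meanUtility ν) q - welfare (meanUtility ν) (p (t + 1) ω) ∂μ := by
        rw [integral_sub (integrable_const _) hwelfare, integral_const, probReal_univ, one_smul]
    _ ≤ ∫ ω, B.indicator 1 ω + 16 * (A + D * W ω) ∂μ :=
        integral_mono_ae ((integrable_const _).sub hwelfare) (hind.add (hloss.const_mul 16))
          (h.ae_welfare_sub_le hν hN hL (meanUtility_mem_Icc hν) ht hmax hq ha)
    _ = μ.real B + 16 * (A + D * ∫ ω, W ω ∂μ) := by
        rw [integral_add hind (hloss.const_mul 16), integral_indicator_one hevent,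
          integral_const_mul, integral_add (integrable_const A) (hwidth.const_mul D),
          integral_const_mul, integral_const, probReal_univ, one_smul]
    _ ≤ _ := by
        rw [h.integral_sum_strategy_mul ht hmeas hbound]
        gcongr

theorem sum_integral_sqWidth_le [IsProbabilityMeasure μ] (h : IsBanditInteraction T ν μ ℱ U p I)
    {L : ℝ} (hL : 0 ≤ L) :
    ∑ t ∈ Finset.range T, ∫ ω, sqWidth L (I · ω) t (I (t + 1) ω) ∂μ
      ≤ 16 * L * (K * (2 + Real.log T)) := by
  have hint : ∀ t ∈ Finset.range T,
      Integrable (fun ω => sqWidth L (I · ω) t (I (t + 1) ω)) μ := fun t ht =>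
    have ht := Finset.mem_range.mp ht
    h.integrable_apply_arm ht (h.measurable_sqWidth ht.le L)
      fun i ω => abs_sqWidth_le hL (I · ω) t i
  rw [← integral_finsetSum _ hint]
  calc _ ≤ ∫ _, 16 * L * (K * (2 + Real.log T)) ∂μ :=
        integral_mono (integrable_finsetSum _ hint) (integrable_const _)
          fun ω => sum_sqWidth_le hL (I · ω) T
    _ = 16 * L * (K * (2 + Real.log T)) := by simp

/-! ### Total regret -/

theorem regret_le_of_forall [IsFiniteMeasure μ] (h : IsBanditInteraction T ν μ ℱ U p I)
    {u : Fin K → Fin N → ℝ} (hu : ∀ i n, u i n ∈ Set.Icc (0 : ℝ) 1) (hK : 0 < K) (hT : 0 < T)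
    {R : ℝ} (hR : ∀ q ∈ stdSimplex ℝ (Fin K),
      ∑ t ∈ Finset.range T, (welfare u q - ∫ ω, welfare u (p (t + 1) ω) ∂μ) ≤ R) :
    regret T u μ p ≤ R := by
  have hsup : sSup (welfare u '' stdSimplex ℝ (Fin K))
      ≤ (R + ∑ t ∈ Finset.range T, ∫ ω, welfare u (p (t + 1) ω) ∂μ) / T := by
    refine csSup_le (Set.Nonempty.image _ ⟨_, single_mem_stdSimplex ℝ (⟨0, hK⟩ : Fin K)⟩) ?_
    rintro _ ⟨q, hq, rfl⟩
    have hregret := hR q hq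
    rw [Finset.sum_sub_distrib, Finset.sum_const, Finset.card_range, nsmul_eq_mul] at hregret
    rw [le_div_iff₀' (by positivity)]
    linarith
  rw [le_div_iff₀' (by positivity)] at hsup
  rw [regret]
  simp only [sum_Icc_one_eq_sum_range]
  rw [integral_finsetSum _ fun t ht => h.integrable_welfare hu (Finset.mem_range.mp ht)]
  linarith

theorem regret_le [IsProbabilityMeasure ν] [IsProbabilityMeasure μ]
    (h : IsBanditInteraction T ν μ ℱ U p I) (hν : ∀ᵐ v ∂ν, ∀ i n, v i n ∈ Set.Icc (0 : ℝ) 1)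
    (hN : 2 ≤ N) (hK : 0 < K) (hT : 0 < T) (hL : 1 / 16 ≤ confidenceParam N K T) {S : Finset ℕ}
    (hmax : ∀ t < T, t + 1 ∉ S → ∀ᵐ ω ∂μ,
      IsMaxOn (welfare (upperConfidence T (I · ω) (U · ω) t)) (stdSimplex ℝ (Fin K))
        (p (t + 1) ω)) {a : ℝ} (ha : 0 < a) :
    regret T (meanUtility ν) μ p ≤ S.card + 4
      + 16 * (T * a ^ (1 / (N : ℝ)) + (a ^ (1 / (N : ℝ) - 1) + 1)
        * (16 * confidenceParam N K T * (K * (2 + Real.log T)))) := by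
  refine h.regret_le_of_forall (meanUtility_mem_Icc hν) hK hT fun q hq => ?_
  set A : ℝ := a ^ (1 / (N : ℝ))
  set D : ℝ := a ^ (1 / (N : ℝ) - 1) + 1
  set W : ℕ → ℝ := fun t => ∫ ω, sqWidth (confidenceParam N K T) (I · ω) t (I (t + 1) ω) ∂μ
  have hW (t : ℕ) : 0 ≤ W t := integral_nonneg fun ω => sqWidth_nonneg (by linarith) _ _ _
  have hround : ∀ t ∈ Finset.range T,
      welfare (meanUtility ν) q - ∫ ω, welfare (meanUtility ν) (p (t + 1) ω) ∂μ
        ≤ (if t + 1 ∈ S then 1 else 0) + (4 / T + 16 * (A + D * W t)) := by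
    intro t ht
    have ht := Finset.mem_range.mp ht
    split_ifs with htS
    · exact (h.welfare_sub_integral_le_one (meanUtility_mem_Icc hν) hq ht).trans
        (le_add_of_nonneg_right (by have := hW t; positivity))
    · rw [zero_add]
      exact h.welfare_sub_integral_le hν hN hK hL ht (hmax t ht htS) hq ha
  have hexceptional : ∑ t ∈ Finset.range T, (if t + 1 ∈ S then (1 : ℝ) else 0) ≤ S.card := by
    rw [Finset.sum_boole]
    exact_mod_cast Finset.card_le_card_of_injOn (· + 1) (fun t ht => (Finset.mem_filter.mp ht).2)
      (add_left_injective 1).injOn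
  calc _ ≤ ∑ t ∈ Finset.range T, ((if t + 1 ∈ S then 1 else 0) + (4 / T + 16 * (A + D * W t))) :=
        Finset.sum_le_sum hround
    _ = ∑ t ∈ Finset.range T, (if t + 1 ∈ S then (1 : ℝ) else 0) + 4
        + 16 * (T * A + D * ∑ t ∈ Finset.range T, W t) := by
        simp only [Finset.sum_add_distrib, ← Finset.mul_sum, Finset.sum_const, Finset.card_range,
          nsmul_eq_mul]
        rw [mul_div_cancel₀ _ (by positivity)]
        ring
    _ ≤ _ := by
        gcongr
        exact h.sum_integral_sqWidth_le (by linarith)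

end IsBanditInteraction

end Interaction

section Rates

variable {N K T : ℕ}

theorem one_div_sixteen_le_confidenceParam (hN : 2 ≤ N) (hK : 0 < K) (hT : 0 < T) :
    1 / 16 ≤ confidenceParam N K T := by
  have hKT : (1 : ℝ) ≤ K * T ^ 2 := by exact_mod_cast Nat.succ_le_of_lt (by positivity)
  calc (1 / 16 : ℝ) ≤ Real.log 2 := by linarith [Real.log_two_gt_d9]
    _ ≤ confidenceParam N K T := by
        rw [confidenceParam, mul_assoc]
        refine Real.log_le_log two_pos ?_
        exact_mod_cast (le_mul_of_le_of_one_le hN (by exact_mod_cast hKT))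

theorem confidenceParam_le (hN : 0 < N) (hK : 0 < K) (hT : 0 < T) :
    confidenceParam N K T ≤ 2 * (1 + Real.log (N * K * T)) := by
  have hN1 : (1 : ℝ) ≤ N := by exact_mod_cast hN
  have hK1 : (1 : ℝ) ≤ K := by exact_mod_cast hK
  calc confidenceParam N K T ≤ Real.log ((N * K * T) ^ 2) := by
        rw [confidenceParam, mul_pow]
        refine Real.log_le_log (by positivity) ?_
        gcongr
        exact le_self_pow₀ (one_le_mul_of_one_le_of_one_le hN1 hK1) two_ne_zero
    _ = 2 * Real.log (N * K * T) := by rw [Real.log_pow, Nat.cast_ofNat]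
    _ ≤ 2 * (1 + Real.log (N * K * T)) := by linarith

theorem two_add_log_le (hN : 0 < N) (hK : 0 < K) (hT : 0 < T) :
    2 + Real.log T ≤ 2 * (1 + Real.log (N * K * T)) := by
  have hNK : (1 : ℝ) ≤ N * K := by exact_mod_cast Nat.mul_pos hN hK
  have hT1 : (1 : ℝ) ≤ T := by exact_mod_cast hT
  have hlog : Real.log T ≤ Real.log (N * K * T) :=
    Real.log_le_log (by positivity) (le_mul_of_one_le_left (by positivity) hNK)
  linarith [Real.log_nonneg hT1]

theorem warmup_length_le (hN : 0 < N) (hK : 0 < K) (hT : 0 < T) :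
    K * (1 + 18 * Real.log (K * T)) ≤ 18 * (1 + Real.log (N * K * T)) ^ 2 * K := by
  have hN1 : (1 : ℝ) ≤ N := by exact_mod_cast hN
  have hKT : (1 : ℝ) ≤ K * T := by exact_mod_cast Nat.mul_pos hK hT
  have hlog : Real.log (K * T) ≤ Real.log (N * K * T) := by
    rw [mul_assoc]
    exact Real.log_le_log (by positivity) (le_mul_of_one_le_left (by positivity) hN1)
  have hnonneg : 0 ≤ Real.log (K * T) := Real.log_nonneg hKT
  rw [mul_comm]
  gcongr
  nlinarith

theorem mul_div_rpow {x y : ℝ} (hx : 0 ≤ x) (hy : 0 < y) (β : ℝ) :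
    y * (x / y) ^ β = x ^ β * y ^ (1 - β) := by
  rw [Real.div_rpow hx hy.le, Real.rpow_sub hy, Real.rpow_one]
  ring

theorem div_rpow_sub_one_mul {x y : ℝ} (hx : 0 < x) (hy : 0 < y) (β : ℝ) :
    (x / y) ^ (β - 1) * x = x ^ β * y ^ (1 - β) := by
  rw [← mul_div_rpow hx.le hy, Real.rpow_sub_one (by positivity)]
  field_simp

theorem sum_width_rate_le (hN : 0 < N) (hK : 0 < K) (hT : 0 < T) {β : ℝ} :
    (((K : ℝ) / T) ^ (β - 1) + 1) * (16 * confidenceParam N K T * (K * (2 + Real.log T)))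
      ≤ 64 * (1 + Real.log (N * K * T)) ^ 2 * ((K : ℝ) ^ β * (T : ℝ) ^ (1 - β) + K) := by
  have hlog : 0 ≤ 2 + Real.log T := add_nonneg zero_le_two (Real.log_natCast_nonneg T)
  have hlogs : confidenceParam N K T * (2 + Real.log T)
      ≤ 4 * (1 + Real.log (N * K * T)) ^ 2 := by
    calc _ ≤ 2 * (1 + Real.log (N * K * T)) * (2 * (1 + Real.log (N * K * T))) :=
          mul_le_mul (confidenceParam_le hN hK hT) (two_add_log_le hN hK hT) hlog
            (hlog.trans (two_add_log_le hN hK hT))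
      _ = 4 * (1 + Real.log (N * K * T)) ^ 2 := by ring
  calc _ = 16 * (confidenceParam N K T * (2 + Real.log T))
        * (((K : ℝ) / T) ^ (β - 1) * K + K) := by ring
    _ = 16 * (confidenceParam N K T * (2 + Real.log T))
        * ((K : ℝ) ^ β * (T : ℝ) ^ (1 - β) + K) := by
        rw [div_rpow_sub_one_mul (by positivity) (by positivity)]
    _ ≤ 16 * (4 * (1 + Real.log (N * K * T)) ^ 2)
        * ((K : ℝ) ^ β * (T : ℝ) ^ (1 - β) + K) := by gcongr
    _ = _ := by ring

theorem floor_warmup_add_rate_le (hN : 0 < N) (hK : 0 < K) (hT : 0 < T) {c : ℝ} (hc : 0 ≤ c) :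
    ⌊K * (1 + 18 * Real.log (K * T))⌋₊ + c * (1 + Real.log (N * K * T)) ^ 2
        * ((K : ℝ) ^ (1 / (N : ℝ)) * (T : ℝ) ^ (((N : ℝ) - 1) / N) + K)
      ≤ (18 + c) * (1 + Real.log (N * K * T)) ^ 2
        * ((K : ℝ) ^ (2 / (N : ℝ)) * (T : ℝ) ^ (((N : ℝ) - 1) / N) + K) := by
  have hlog : 0 ≤ Real.log (K * T) := by exact_mod_cast Real.log_natCast_nonneg (K * T)
  rw [add_mul, add_mul]
  gcongr ?_ + _ * _ * (?_ * _ + _)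
  · calc _ ≤ K * (1 + 18 * Real.log (K * T)) := Nat.floor_le (by positivity)
      _ ≤ 18 * (1 + Real.log (N * K * T)) ^ 2 * K := warmup_length_le hN hK hT
      _ ≤ _ := by
          gcongr
          exact le_add_of_nonneg_left (by positivity)
  · gcongr
    · exact_mod_cast hK
    · exact one_le_two

end Rates

theorem PlaysUCB.ae_isMaxOn {Ω : Type*} {mΩ : MeasurableSpace Ω} {K N T : ℕ} {N₀ : ℝ}
    {μ : Measure Ω} {U : ℕ → Ω → Fin K → Fin N → ℝ} {p : ℕ → Ω → Fin K → ℝ} {I : ℕ → Ω → Fin K}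
    (h : PlaysUCB T N₀ μ U p I) {t : ℕ} (ht : t < T) (hwarm : t + 1 ∉ Finset.Icc 1 ⌊K * N₀⌋₊) :
    ∀ᵐ ω ∂μ, IsMaxOn (welfare (upperConfidence T (I · ω) (U · ω) t)) (stdSimplex ℝ (Fin K))
      (p (t + 1) ω) :=
  h.optimistic t ht <| by
    rw [Finset.mem_Icc, not_and, not_le] at hwarm
    exact Nat.lt_of_floor_lt (hwarm (by omega))

end NashBandit

theorem theorem1_general {N K T : ℕ} (hN : 2 ≤ N) (hK : 1 ≤ K) (hT : 1 ≤ T)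
    {ν : Measure (Fin K → Fin N → ℝ)} [IsProbabilityMeasure ν]
    (hν : ∀ᵐ v ∂ν, ∀ i n, v i n ∈ Set.Icc (0 : ℝ) 1)
    {Ω : Type*} {mΩ : MeasurableSpace Ω} {μ : Measure Ω} [IsProbabilityMeasure μ]
    {ℱ : Filtration ℕ mΩ} {U : ℕ → Ω → Fin K → Fin N → ℝ} {p : ℕ → Ω → Fin K → ℝ}
    {I : ℕ → Ω → Fin K} (h : NashBandit.IsBanditInteraction T ν μ ℱ U p I) (S : Finset ℕ)
    (hmax : ∀ t < T, t + 1 ∉ S → ∀ᵐ ω ∂μ,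
      IsMaxOn (NashBandit.welfare (NashBandit.upperConfidence T (I · ω) (U · ω) t))
        (stdSimplex ℝ (Fin K)) (p (t + 1) ω)) :
    NashBandit.regret T (NashBandit.meanUtility ν) μ p ≤
      S.card + 1044 * (1 + Real.log (N * K * T)) ^ 2 *
        ((K : ℝ) ^ (1 / (N : ℝ)) * (T : ℝ) ^ (((N : ℝ) - 1) / (N : ℝ)) + K) := by
  have hregret := h.regret_le hν hN hK hT
    (NashBandit.one_div_sixteen_le_confidenceParam hN hK hT) hmax (a := K / T) (by positivity)
  rw [NashBandit.mul_div_rpow (by positivity) (by positivity)] at hregret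
  have hwidth := NashBandit.sum_width_rate_le (β := 1 / N) (by omega : 0 < N) hK hT
  rw [sub_div, div_self (by positivity)]
  set l := 1 + Real.log (N * K * T)
  set R : ℝ := (K : ℝ) ^ (1 / (N : ℝ)) * (T : ℝ) ^ (1 - 1 / (N : ℝ))
  have hR : 0 ≤ R := by positivity
  have hK1 : (1 : ℝ) ≤ K := by exact_mod_cast hK
  have hl : 1 ≤ l ^ 2 := one_le_pow₀ <| le_add_of_nonneg_right <| by
    exact_mod_cast Real.log_natCast_nonneg (N * K * T)
  have hbase : R + K ≤ l ^ 2 * (R + K) := le_mul_of_one_le_left (by positivity) hl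
  linarith

theorem theorem1 :
    ∃ (C : ℝ) (m : ℕ), ∀ (N K T : ℕ), 2 ≤ N → 1 ≤ K → 1 ≤ T →
      ∀ (ν : Measure (Fin K → Fin N → ℝ)) [IsProbabilityMeasure ν],
        (∀ᵐ v ∂ν, ∀ i n, v i n ∈ Set.Icc (0 : ℝ) 1) →
      ∀ (Ω : Type*) (mΩ : MeasurableSpace Ω) (μ : Measure Ω) [IsProbabilityMeasure μ]
        (ℱ : Filtration ℕ mΩ) (U : ℕ → Ω → Fin K → Fin N → ℝ) (p : ℕ → Ω → Fin K → ℝ)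
        (I : ℕ → Ω → Fin K),
        NashBandit.IsBanditInteraction T ν μ ℱ U p I →
        NashBandit.PlaysUCB T (1 + 18 * Real.log (K * T)) μ U p I →
        NashBandit.regret T (NashBandit.meanUtility ν) μ p ≤
          C * (1 + Real.log (N * K * T)) ^ m *
            ((K : ℝ) ^ (2 / (N : ℝ)) * (T : ℝ) ^ (((N : ℝ) - 1) / (N : ℝ)) + K) := by
  refine ⟨18 + 1044, 2, fun N K T hN hK hT ν _ hν Ω mΩ μ _ ℱ U p I hint hucb => ?_⟩
  refine (theorem1_general hN hK hT hν hint _ fun _ => hucb.ae_isMaxOn).trans ?_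
  simpa using NashBandit.floor_warmup_add_rate_le (by omega : 0 < N) hK hT (c := 1044) (by simp)
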